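/- A *selfadjoint operator space* is a norm-closed selfadjoint linear subspace $E$ of a C*-algebra $\mathcal C$ (equivalently, of some $\mathcal B(H)$), with the matrix norms and the matrix cones $M_n(E)_+ = M_n(E)\cap M_n(\mathcal C)_+$ inherited from the C*-algebras $M_n(\mathcal C)$. For selfadjoint operator spaces $E, F$ let $\mathrm{CCP}(E,F)$ be the set of completely contractive completely positive (in particular selfadjoint) linear maps $E \to F$. The unitisation $E^\#$ of $E$ is the $*$-vector space $E\oplus\mathbb C$ in which a selfadjoint $(x,a)\in M_n(E^\#)$ is positive if and only if $a\ge 0$ and $\varphi\big((a+\varepsilon I)^{-1/2}\,x\,(a+\varepsilon I)^{-1/2}\big)\ge -1$ for all $\varepsilon>0$ and all $\varphi\in \mathrm{CCP}(M_n(E),\mathbb C)$. A *complete order embedding* is an injective completely positive map whose inverse on its image is completely positive. A linear map $\theta\colon E\to F$ is an *embedding* if it is a completely isometric complete order embedding and $\theta^\#\colon E^\#\to F^\#$, $(x,a)\mapsto(\theta(x),a)$, is a unital complete order embedding. **Theorem.** Let $\mathcal C$ be a (not necessarily unital) C*-algebra, let $x\in\mathcal C$ be selfadjoint with positive and negative parts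 $x_+$ and $x_-$, and let $E=\operatorname{span}\{x\}$. If $x_+=0$ or $x_-=0$, then the inclusion $E\subseteq\mathcal C$ is an embedding, and so is the inclusion $E\subseteq \mathrm C^*(E)$ into the C*-subalgebra of $\mathcal C$ generated by $E$. -/

import Mathlib

noncomputable section

open scoped ComplexOrder

universe u v

/-! ### Matrix ordered `*`-vector spaces: complete positivity and complete order embeddings -/

section MatrixOrder

variable {V : Type u} {W : Type v} [AddCommGroup V] [Module ℂ V] [Star V]
  [AddCommGroup W] [Module ℂ W] [Star W]

/-- A linear map between `*`-vector spaces with matrix cones `C n ⊆ M_n(V)`, `D n ⊆ M_n(W)` is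
completely positive if it is selfadjoint and all its amplifications preserve the cones. -/
def IsCompletelyPositive (C : ∀ n : ℕ, Set (Matrix (Fin n) (Fin n) V))
    (D : ∀ n : ℕ, Set (Matrix (Fin n) (Fin n) W)) (φ : V →ₗ[ℂ] W) : Prop :=
  (∀ v : V, φ (star v) = star (φ v)) ∧
    ∀ (n : ℕ) (X : Matrix (Fin n) (Fin n) V), X ∈ C n → X.map φ ∈ D n

/-- A complete order embedding: a completely positive map that is invertible onto its image with
completely positive inverse. (The inverse of a selfadjoint map is automatically selfadjoint.) -/
structure IsCompleteOrderEmbedding (C : ∀ n : ℕ, Set (Matrix (Fin n) (Fin n) V))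
    (D : ∀ n : ℕ, Set (Matrix (Fin n) (Fin n) W)) (φ : V →ₗ[ℂ] W) : Prop where
  injective : Function.Injective φ
  completelyPositive : IsCompletelyPositive C D φ
  inverse_positive : ∀ (n : ℕ) (X : Matrix (Fin n) (Fin n) V), X.map φ ∈ D n → X ∈ C n

/-- The product `b X c` of scalar matrices `b`, `c` with a matrix `X` over a complex vector
space. -/
def scalarSandwich {n : ℕ} (b : Matrix (Fin n) (Fin n) ℂ) (X : Matrix (Fin n) (Fin n) V)
    (c : Matrix (Fin n) (Fin n) ℂ) : Matrix (Fin n) (Fin n) V :=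
  Matrix.of fun i j => ∑ k, ∑ l, (b i k * c l j) • X k l

end MatrixOrder

/-! ### Selfadjoint operator spaces -/

/-- A selfadjoint operator space, realised concretely as a norm-closed selfadjoint linear subspace
of a C⋆-algebra `A`. Its matrix norms and matrix cones are inherited from the C⋆-algebras
`M_n(A)`. -/
structure SelfadjointOperatorSpace (A : Type u) [NonUnitalCStarAlgebra A] extends
    Submodule ℂ A where
  star_mem' : ∀ a ∈ toSubmodule, star a ∈ toSubmodule
  isClosed' : IsClosed (toSubmodule : Set A)

namespace SelfadjointOperatorSpace

section Basic

variable {A : Type u} [NonUnitalCStarAlgebra A]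

instance instStar (E : SelfadjointOperatorSpace A) : Star E.toSubmodule where
  star x := ⟨star (x : A), E.star_mem' x x.2⟩

/-- A C⋆-algebra as a selfadjoint operator space. -/
def whole (A : Type u) [NonUnitalCStarAlgebra A] : SelfadjointOperatorSpace A where
  toSubmodule := ⊤
  star_mem' := fun _ _ => Submodule.mem_top
  isClosed' := by simp

/-- The one-dimensional (or zero) selfadjoint operator space spanned by a selfadjoint element. -/
def spanSingleton (x : A) (hx : IsSelfAdjoint x) : SelfadjointOperatorSpace A where
  toSubmodule := Submodule.span ℂ {x}
  star_mem' := by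
    intro a ha
    obtain ⟨c, rfl⟩ := Submodule.mem_span_singleton.mp ha
    rw [star_smul, hx.star_eq]
    exact Submodule.smul_mem _ _ (Submodule.mem_span_singleton_self x)
  isClosed' := Submodule.closed_of_finiteDimensional _

/-- The C⋆-algebra `C⋆(E)` generated by `E` in `A`, again as a selfadjoint operator space in `A`:
the norm closure of the (non-unital) `*`-algebra generated by `E`. -/
def generatedCStarAlgebra (E : SelfadjointOperatorSpace A) : SelfadjointOperatorSpace A where
  toSubmodule :=
    (NonUnitalStarAlgebra.adjoin ℂ (E.toSubmodule : Set A)).topologicalClosure.toSubmodule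
  star_mem' := fun _ ha =>
    (NonUnitalStarAlgebra.adjoin ℂ (E.toSubmodule : Set A)).topologicalClosure.star_mem' ha
  isClosed' :=
    (NonUnitalStarAlgebra.adjoin ℂ (E.toSubmodule : Set A)).isClosed_topologicalClosure

theorem le_whole (E : SelfadjointOperatorSpace A) :
    E.toSubmodule ≤ (whole A).toSubmodule := le_top

theorem le_generatedCStarAlgebra (E : SelfadjointOperatorSpace A) :
    E.toSubmodule ≤ E.generatedCStarAlgebra.toSubmodule := fun _ ha =>
  NonUnitalStarSubalgebra.le_topologicalClosure _ (NonUnitalStarAlgebra.subset_adjoin ℂ _ ha)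

/-- The inclusion map of `E` into `F`. -/
def inclusion (E F : SelfadjointOperatorSpace A) (h : E.toSubmodule ≤ F.toSubmodule) :
    E.toSubmodule →ₗ[ℂ] F.toSubmodule :=
  Submodule.inclusion h

end Basic

section Matrices

variable {A : Type u} [NonUnitalCStarAlgebra A] [PartialOrder A] [StarOrderedRing A]

/-- A matrix with entries in `E ⊆ A`, seen in the C⋆-algebra `M_n(A)`. -/
def toCStarMatrix (E : SelfadjointOperatorSpace A) {n : ℕ}
    (X : Matrix (Fin n) (Fin n) E.toSubmodule) : CStarMatrix (Fin n) (Fin n) A :=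
  CStarMatrix.ofMatrix (X.map fun e => (e : A))

/-- The positive cone `M_n(E)_+ = M_n(E) ∩ M_n(A)_+`. -/
def cone (E : SelfadjointOperatorSpace A) (n : ℕ) :
    Set (Matrix (Fin n) (Fin n) E.toSubmodule) :=
  {X | 0 ≤ E.toCStarMatrix X}

/-- `M_n(E)` as a selfadjoint operator space in `M_n(A)`. -/
def matrixSpace (n : ℕ) (E : SelfadjointOperatorSpace A) :
    SelfadjointOperatorSpace (CStarMatrix (Fin n) (Fin n) A) where
  carrier := {X | ∀ i j, X i j ∈ E.toSubmodule}
  add_mem' := fun hX hY i j => E.toSubmodule.add_mem (hX i j) (hY i j)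
  zero_mem' := fun _ _ => E.toSubmodule.zero_mem
  smul_mem' := fun c _ hX i j => E.toSubmodule.smul_mem c (hX i j)
  star_mem' := fun _ hX i j => E.star_mem' _ (hX j i)
  isClosed' := by
    have h : IsClosed {X : Matrix (Fin n) (Fin n) A | ∀ i j, X i j ∈ E.toSubmodule} := by
      simp only [Set.ofPred_forall]
      exact isClosed_iInter fun i => isClosed_iInter fun j =>
        E.isClosed'.preimage ((continuous_apply j).comp (continuous_apply i))
    exact h

/-- A matrix with entries in `E`, as an element of the selfadjoint operator space `M_n(E)`. -/
def toMatrixSpace (E : SelfadjointOperatorSpace A) {n : ℕ}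
    (X : Matrix (Fin n) (Fin n) E.toSubmodule) : (E.matrixSpace n).toSubmodule :=
  ⟨E.toCStarMatrix X, fun i j => (X i j).2⟩

end Matrices

section Maps

variable {A : Type u} [NonUnitalCStarAlgebra A] [PartialOrder A] [StarOrderedRing A]
  {B : Type v} [NonUnitalCStarAlgebra B] [PartialOrder B] [StarOrderedRing B]

/-- All amplifications of `φ` are contractive. -/
def IsCompletelyContractive {E : SelfadjointOperatorSpace A} {F : SelfadjointOperatorSpace B}
    (φ : E.toSubmodule →ₗ[ℂ] F.toSubmodule) : Prop :=
  ∀ (n : ℕ) (X : Matrix (Fin n) (Fin n) E.toSubmodule),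
    ‖F.toCStarMatrix (X.map φ)‖ ≤ ‖E.toCStarMatrix X‖

/-- All amplifications of `φ` are isometric. -/
def IsCompletelyIsometric {E : SelfadjointOperatorSpace A} {F : SelfadjointOperatorSpace B}
    (φ : E.toSubmodule →ₗ[ℂ] F.toSubmodule) : Prop :=
  ∀ (n : ℕ) (X : Matrix (Fin n) (Fin n) E.toSubmodule),
    ‖F.toCStarMatrix (X.map φ)‖ = ‖E.toCStarMatrix X‖

/-- The set of completely contractive completely positive maps from `E` to `F`. -/
def CCP (E : SelfadjointOperatorSpace A) (F : SelfadjointOperatorSpace B) :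
    Set (E.toSubmodule →ₗ[ℂ] F.toSubmodule) :=
  {φ | IsCompletelyContractive φ ∧ IsCompletelyPositive E.cone F.cone φ}

open scoped MatrixOrder in
/-- The matrix `(a + ε I)^{-1/2}`, for a positive semidefinite complex matrix `a` and `ε > 0`. -/
def regularisedInvSqrt {n : ℕ} (a : Matrix (Fin n) (Fin n) ℂ) (ε : ℝ) :
    Matrix (Fin n) (Fin n) ℂ :=
  (a + (ε : ℂ) • (1 : Matrix (Fin n) (Fin n) ℂ)) ^ (-(1 / 2) : ℝ)

/-- The positive cone of `M_n(E^#)` for Werner's unitisation `E^# = E ⊕ ℂ`: a selfadjoint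
`Z = (x, a) ∈ M_n(E^#)` is positive if `a ≥ 0` and, with `a_ε = a + ε I`,
`φ(a_ε^{-1/2} x a_ε^{-1/2}) ≥ -1` for all `ε > 0` and all `φ ∈ CCP(M_n(E), ℂ)`.
(The values of `φ` here are real, since `φ` is selfadjoint.) -/
def unitisationCone (E : SelfadjointOperatorSpace A) (n : ℕ) :
    Set (Matrix (Fin n) (Fin n) (E.toSubmodule × ℂ)) :=
  {Z | IsSelfAdjoint Z ∧ (Z.map Prod.snd).PosSemidef ∧
    ∀ ε : ℝ, 0 < ε → ∀ φ ∈ CCP (E.matrixSpace n) (whole ℂ),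
      -1 ≤ (φ (E.toMatrixSpace (scalarSandwich (regularisedInvSqrt (Z.map Prod.snd) ε)
        (Z.map Prod.fst) (regularisedInvSqrt (Z.map Prod.snd) ε))) : ℂ).re}

/-- The unitisation `θ^# : E^# → F^#`, `(x, a) ↦ (θ x, a)`. -/
def unitisationMap {E : SelfadjointOperatorSpace A} {F : SelfadjointOperatorSpace B}
    (θ : E.toSubmodule →ₗ[ℂ] F.toSubmodule) :
    (E.toSubmodule × ℂ) →ₗ[ℂ] (F.toSubmodule × ℂ) :=
  θ.prodMap LinearMap.id

/-- `θ` is an embedding: a completely isometric complete order embedding whose unitisation is a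
unital complete order embedding. -/
structure IsEmbedding {E : SelfadjointOperatorSpace A} {F : SelfadjointOperatorSpace B}
    (θ : E.toSubmodule →ₗ[ℂ] F.toSubmodule) : Prop where
  completelyIsometric : IsCompletelyIsometric θ
  completeOrderEmbedding : IsCompleteOrderEmbedding E.cone F.cone θ
  unitisation_unital : unitisationMap θ (0, 1) = (0, 1)
  unitisation_completeOrderEmbedding :
    IsCompleteOrderEmbedding E.unitisationCone F.unitisationCone (unitisationMap θ)

end Maps

end SelfadjointOperatorSpace

end

/-! Replacing `x` by `-x` if necessary, `E` is spanned by some `h ≥ 0`. Norms and cones of `E` and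
`F` come from the same ambient algebra, so only the unitisation needs an argument, and there only
the inverse: a lower bound `-1` under all CCP functionals of `M_n(F)` must pass to those of
`M_n(E)`.

No functional has to be extended. An element of `M_n(E)` has the form `b ⊗ h` with `b` a scalar
matrix. Take a contractive positive functional `ω` with `ω(h) = ‖h‖`
(`exists_contractive_positive_eq_norm`). Composing it with compressions by scalar vectors gives test
functionals on `M_n(F)` (`restrictFunctional_mem_CCP`), and these yield `‖h‖ Re⟨bα, α⟩ ≥ -‖α‖²`,
that is, `‖h‖(b + b*) + 2 ≥ 0`. Tensoring with `h` preserves positivity, so applying `φ` gives `‖h‖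
Re φ(b ⊗ h) ≥ -φ(1 ⊗ h) ≥ -‖h‖`; now divide by `‖h‖` (`neg_one_le_re_of_forall_CCP`). -/

noncomputable section

open scoped ComplexOrder

/-! ### Norms of vectors in C⋆-modules. -/

section CStarModuleNorms

theorem WithCStarModule.norm_smul_const {A ι : Type*} [NonUnitalCStarAlgebra A]
    [PartialOrder A] [StarOrderedRing A] [Fintype ι] (γ : ι → ℂ) (a : A) :
    ‖((WithCStarModule.equiv A _).symm fun i => γ i • a : WithCStarModule A (ι → A))‖ =
      √(∑ i, ‖γ i‖ ^ 2) * ‖a‖ := by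
  rw [WithCStarModule.pi_norm]
  have : ∑ i, inner A (γ i • a) (γ i • a) = ((∑ i, ‖γ i‖ ^ 2 : ℝ) : ℂ) • (a * star a) := by
    push_cast
    rw [Finset.sum_smul]
    refine Finset.sum_congr rfl fun i _ => ?_
    rw [WithCStarModule.inner_def, star_smul, smul_mul_smul_comm, ← Complex.mul_conj']
    rfl
  simp only [WithCStarModule.equiv_symm_pi_apply]
  rw [this, norm_smul, CStarRing.norm_self_mul_star, Real.sqrt_mul (norm_nonneg _),
    Real.sqrt_mul_self (norm_nonneg _), Complex.norm_real,
    Real.norm_of_nonneg (Finset.sum_nonneg fun i _ => sq_nonneg _)]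

theorem WithCStarModule.norm_eq_sqrt_sum_sq {ι : Type*} [Fintype ι]
    (u : WithCStarModule ℂ (ι → ℂ)) : ‖u‖ = √(∑ i, ‖u i‖ ^ 2) := by
  have : ∑ i, inner ℂ (u i) (u i) = ((∑ i, ‖u i‖ ^ 2 : ℝ) : ℂ) := by
    push_cast
    refine Finset.sum_congr rfl fun i _ => ?_
    rw [← Complex.mul_conj']
    rfl
  rw [WithCStarModule.pi_norm, this, Complex.norm_real,
    Real.norm_of_nonneg (Finset.sum_nonneg fun i _ => sq_nonneg _)]

end CStarModuleNorms

theorem exists_star_mul_self_of_nonneg {B : Type*} [NonUnitalCStarAlgebra B] [PartialOrder B]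
    [StarOrderedRing B] {b : B} (hb : 0 ≤ b) : ∃ s, b = star s * s :=
  CStarAlgebra.nonneg_iff_eq_star_mul_self.mp hb

/-! ### Scalar pairings and compressions of C⋆-matrices. -/

namespace CStarMatrix

/-- The expression `∑ i, ∑ j, (α i * β j) • M i j` is bounded by the norm of `M`. -/
theorem norm_sum_smul_apply_le {A m n : Type*} [NonUnitalCStarAlgebra A]
    [PartialOrder A] [StarOrderedRing A] [Fintype m] [Fintype n] (M : CStarMatrix m n A)
    (α : m → ℂ) (β : n → ℂ) :
    ‖∑ i, ∑ j, (α i * β j) • M i j‖ ≤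
      ‖M‖ * √(∑ i, ‖α i‖ ^ 2) * √(∑ j, ‖β j‖ ^ 2) := by
  set y := ∑ i, ∑ j, (α i * β j) • M i j with hy
  -- `A` may lack a unit, so `y` itself is not visibly an inner product; `d * y * c` is one, and
  -- Cauchy–Schwarz applies.
  have key (d c : A) : ‖d * y * c‖ ≤
      (‖M‖ * √(∑ i, ‖α i‖ ^ 2) * √(∑ j, ‖β j‖ ^ 2)) * (‖d‖ * ‖c‖) := by
    let v : WithCStarModule A (m → A) := (WithCStarModule.equiv A _).symm fun i => α i • d
    let w : WithCStarModule A (n → A) :=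
      (WithCStarModule.equiv A _).symm fun j => star (β j) • star c
    have h1 : inner A w (toCLM M v) = d * y * c := by
      simp only [WithCStarModule.pi_inner, toCLM_apply_eq_sum, v, w,
        WithCStarModule.equiv_symm_pi_apply, WithCStarModule.inner_def, star_smul, star_star, hy,
        Finset.mul_sum, Finset.sum_mul]
      rw [Finset.sum_comm]
      refine Finset.sum_congr rfl fun i _ => Finset.sum_congr rfl fun j _ => ?_
      simp only [smul_mul_assoc, mul_smul_comm, smul_smul, mul_comm (α i)]
    have hv : ‖v‖ = √(∑ i, ‖α i‖ ^ 2) * ‖d‖ := WithCStarModule.norm_smul_const _ _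
    have hw : ‖w‖ = √(∑ i, ‖β i‖ ^ 2) * ‖c‖ := by
      simpa only [norm_star] using WithCStarModule.norm_smul_const (fun j => star (β j)) (star c)
    rw [← h1]
    calc _ ≤ ‖w‖ * ‖toCLM M v‖ := CStarModule.norm_inner_le _
      _ ≤ ‖w‖ * (‖M‖ * ‖v‖) := by
        gcongr
        exact (toCLM M).le_opNorm v
      _ = _ := by
        rw [hv, hw]
        ring
  rcases eq_or_ne y 0 with h0 | h0
  · rw [h0, norm_zero]; positivity
  · have hpos : 0 < ‖y‖ := norm_pos_iff.mpr h0
    -- With these factors `d * y * c` is `(y* y)²`, of norm `‖y‖⁴`, while `‖d‖ ‖c‖ = ‖y‖³`;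
    -- cancelling leaves the bound on `‖y‖`.
    have h2 := key (star y) (star y * y)
    have h3 : star y * y * (star y * y) = star (star y * y) * (star y * y) := by simp
    rw [h3, CStarRing.norm_star_mul_self, CStarRing.norm_star_mul_self, norm_star] at h2
    refine le_of_mul_le_mul_right (a := ‖y‖ * (‖y‖ * ‖y‖)) ?_ (by positivity)
    linarith

/-- For scalar matrices the pairings with vectors determine the operator norm, so the preceding
estimate has a converse. -/
theorem norm_le_of_forall_norm_sum_le {m n : Type*} [Fintype m] [Fintype n]
    (M : CStarMatrix m n ℂ) {K : ℝ} (hK : 0 ≤ K)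
    (h : ∀ (α : m → ℂ) (β : n → ℂ), ‖∑ i, ∑ j, (α i * β j) • M i j‖ ≤
      K * √(∑ i, ‖α i‖ ^ 2) * √(∑ j, ‖β j‖ ^ 2)) : ‖M‖ ≤ K := by
  lift K to NNReal using hK
  refine norm_le_of_forall_inner_le fun v w => ?_
  have h1 : inner ℂ w (toCLM M v) = ∑ i, ∑ j, (v i * star (w j)) • M i j := by
    simp only [WithCStarModule.pi_inner, toCLM_apply_eq_sum,
      WithCStarModule.equiv_symm_pi_apply, WithCStarModule.inner_def, Finset.sum_mul]
    rw [Finset.sum_comm]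
    refine Finset.sum_congr rfl fun i _ => Finset.sum_congr rfl fun j _ => ?_
    simp only [smul_eq_mul]
    ring
  rw [h1, WithCStarModule.norm_eq_sqrt_sum_sq v, WithCStarModule.norm_eq_sqrt_sum_sq w]
  simpa only [norm_star] using h (fun i => v i) (fun j => star (w j))

/-- The compression `M ↦ α* M α` of matrices by a scalar vector `α`. -/
def compression {n A : Type*} [Fintype n] [AddCommGroup A] [Module ℂ A] (α : n → ℂ) :
    CStarMatrix n n A →ₗ[ℂ] A where
  toFun M := ∑ i, ∑ j, (star (α i) * α j) • M i j
  map_add' M N := by simp [Finset.sum_add_distrib]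
  map_smul' c M := by simp [Finset.smul_sum, smul_comm c]

theorem compression_apply {n A : Type*} [Fintype n] [AddCommGroup A] [Module ℂ A] (α : n → ℂ)
    (M : CStarMatrix n n A) :
    compression α M = ∑ i, ∑ j, (star (α i) * α j) • M i j := rfl

section Order

variable {n A : Type*} [Fintype n] [NonUnitalCStarAlgebra A] [PartialOrder A] [StarOrderedRing A]

theorem compression_nonneg (α : n → ℂ) {M : CStarMatrix n n A} (hM : 0 ≤ M) :
    0 ≤ compression α M := by
  obtain ⟨S, rfl⟩ := exists_star_mul_self_of_nonneg hM
  -- This is `α* S* S α = (Sα)* (Sα)`, written in coordinates.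
  have : compression α (star S * S) = ∑ k, star (∑ i, α i • S k i) * ∑ j, α j • S k j := by
    simp only [compression_apply, mul_apply, star_apply, star_sum, star_smul, Finset.sum_mul,
      Finset.mul_sum, Finset.smul_sum, smul_mul_smul_comm]
    rw [Finset.sum_comm' (t' := Finset.univ) (s' := fun _ => Finset.univ) (by simp)]
    conv_lhs => enter [2, i]; rw [Finset.sum_comm]
    rw [Finset.sum_comm]
  rw [this]
  exact Finset.sum_nonneg fun k _ => star_mul_self_nonneg _

theorem norm_compression_le (α : n → ℂ) (M : CStarMatrix n n A) :
    ‖compression α M‖ ≤ (∑ i, ‖α i‖ ^ 2) * ‖M‖ := by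
  have h := norm_sum_smul_apply_le M (fun i => star (α i)) α
  simp only [norm_star] at h
  rw [mul_assoc, Real.mul_self_sqrt (Finset.sum_nonneg fun i _ => sq_nonneg _), mul_comm] at h
  exact h

theorem nonneg_of_posSemidef {M : CStarMatrix n n ℂ} [DecidableEq n]
    (hM : Matrix.PosSemidef (ofMatrix.symm M)) : 0 ≤ M := by
  open scoped MatrixOrder in
  obtain ⟨S, hS⟩ := CStarAlgebra.nonneg_iff_eq_star_mul_self.mp hM.nonneg
  rw [show M = star (ofMatrix S) * ofMatrix S from hS]
  exact star_mul_self_nonneg _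

end Order

end CStarMatrix

/-! ### Positive contractive functionals are automatically CCP. -/

section Functionals

variable {B : Type*} [NonUnitalCStarAlgebra B] [PartialOrder B] [StarOrderedRing B]

theorem map_star_of_forall_nonneg (g : B →ₗ[ℂ] ℂ) (hg : ∀ b, 0 ≤ b → 0 ≤ g b) (b : B) :
    g (star b) = star (g b) := by
  obtain ⟨y, hy, -, rfl⟩ := CStarAlgebra.exists_sum_four_nonneg b
  have h (i) : star (g (y i)) = g (y i) := (hg _ (hy i)).isSelfAdjoint.star_eq
  simp only [star_sum, star_smul, map_sum, map_smul, (hy _).isSelfAdjoint.star_eq, h]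

/-- The restriction of a linear functional to a selfadjoint operator space. -/
def SelfadjointOperatorSpace.restrictFunctional (G : SelfadjointOperatorSpace B)
    (g : B →ₗ[ℂ] ℂ) : G.toSubmodule →ₗ[ℂ] (SelfadjointOperatorSpace.whole ℂ).toSubmodule :=
  (g.comp G.toSubmodule.subtype).codRestrict _ fun _ => Submodule.mem_top

/-- Contractive positive functionals restrict to completely contractive completely positive
maps. -/
theorem SelfadjointOperatorSpace.restrictFunctional_mem_CCP (G : SelfadjointOperatorSpace B)
    (g : B →ₗ[ℂ] ℂ) (hnorm : ∀ b, ‖g b‖ ≤ ‖b‖) (hg : ∀ b, 0 ≤ b → 0 ≤ g b) :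
    G.restrictFunctional g ∈ CCP G (whole ℂ) := by
  refine ⟨fun n X => ?_, fun v => Subtype.ext (map_star_of_forall_nonneg g hg v), fun n X hX => ?_⟩
  -- Pairing the amplified `g` at `X` with scalar vectors is `g` of the pairing of `X`, so
  -- contractivity at level one suffices.
  · refine CStarMatrix.norm_le_of_forall_norm_sum_le _ (norm_nonneg _) fun α β => ?_
    refine le_trans ?_ (CStarMatrix.norm_sum_smul_apply_le (G.toCStarMatrix X) α β)
    refine le_trans (le_of_eq ?_) (hnorm _)
    simp only [map_sum, map_smul]
    rfl
  · refine CStarMatrix.nonneg_of_posSemidef (.of_dotProduct_mulVec_nonneg ?_ fun α => ?_)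
    · have hX' : star (G.toCStarMatrix X) = G.toCStarMatrix X :=
        (show 0 ≤ G.toCStarMatrix X from hX).isSelfAdjoint.star_eq
      ext i j
      have := congrArg g (congrFun (congrFun hX' i) j)
      rw [CStarMatrix.star_apply, map_star_of_forall_nonneg g hg] at this
      exact this
    · have h : 0 ≤ g (CStarMatrix.compression α (G.toCStarMatrix X)) :=
        hg _ (CStarMatrix.compression_nonneg α hX)
      convert h using 1
      simp only [CStarMatrix.compression_apply, map_sum, map_smul, dotProduct, Matrix.mulVec,
        Finset.mul_sum]
      refine Finset.sum_congr rfl fun i _ => Finset.sum_congr rfl fun j _ => ?_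
      rw [smul_eq_mul, mul_right_comm, mul_assoc]
      rfl

end Functionals

/-! ### Norming positive functionals. -/

section States

theorem IsSelfAdjoint.norm_add_algebraMap_I_sq_le {A : Type*} [CStarAlgebra A] {a : A}
    (ha : IsSelfAdjoint a) (t : ℝ) :
    ‖a + algebraMap ℂ A (t * Complex.I)‖ ^ 2 ≤ ‖a‖ ^ 2 + t ^ 2 := by
  have h : star (a + algebraMap ℂ A (t * Complex.I)) * (a + algebraMap ℂ A (t * Complex.I)) =
      a * a + algebraMap ℂ A ((t : ℂ) ^ 2) := by
    simp only [Algebra.algebraMap_eq_smul_one, star_add, star_smul, star_one, ha.star_eq, add_mul,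
      mul_add, smul_mul_assoc, mul_smul_comm, one_mul, mul_one]
    have h2 : star ((t : ℂ) * Complex.I) = -(t * Complex.I) := by simp
    have h3 : -((t : ℂ) * Complex.I) * (t * Complex.I) = (t : ℂ) ^ 2 := by
      linear_combination (-(t : ℂ) ^ 2) * Complex.I_mul_I
    rw [h2, smul_add, smul_smul, mul_comm _ (-((t : ℂ) * Complex.I)), h3, neg_smul]
    abel
  rw [sq, ← CStarRing.norm_star_mul_self, h]
  refine (norm_add_le _ _).trans (add_le_add ?_ ?_)
  · rw [sq]; exact norm_mul_le _ _
  · rw [Algebra.algebraMap_eq_smul_one, norm_smul]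
    refine (mul_le_of_le_one_right (norm_nonneg _) ?_).trans (by simp)
    nontriviality A
    simp

/-- The spectrum of `a` lies in `[0, ‖a‖]`, where `|2x - ‖a‖| ≤ ‖a‖`. This bound serves both to
normalise a norming functional and to prove its positivity. -/
theorem norm_two_smul_sub_algebraMap_norm_le {A : Type*} [CStarAlgebra A] [PartialOrder A]
    [StarOrderedRing A] {a : A} (ha : 0 ≤ a) : ‖(2 : ℝ) • a - algebraMap ℝ A ‖a‖‖ ≤ ‖a‖ := by
  have hsa : IsSelfAdjoint a := ha.isSelfAdjoint
  have h : (2 : ℝ) • a - algebraMap ℝ A ‖a‖ = cfc (fun x : ℝ => 2 * x - ‖a‖) a := by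
    rw [cfc_sub (fun x : ℝ => 2 * x) (fun _ => ‖a‖) a, cfc_const_mul_id 2 a, cfc_const ‖a‖ a]
  rw [h]
  refine norm_cfc_le (norm_nonneg _) fun x hx => ?_
  have h0 : 0 ≤ x := spectrum_nonneg_of_nonneg ha hx
  have h1 : x ≤ ‖a‖ := by
    have : Nontrivial A := by
      by_contra h
      rw [not_nontrivial_iff_subsingleton] at h
      simp [spectrum.of_subsingleton] at hx
    exact (Real.le_norm_self x).trans (spectrum.norm_le_norm_of_mem hx)
  rw [Real.norm_eq_abs, abs_le]
  constructor <;> linarith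

theorem nonneg_of_unital_contractive {A : Type*} [CStarAlgebra A] [PartialOrder A]
    [StarOrderedRing A] (f : A →ₗ[ℂ] ℂ) (hf : ∀ a, ‖f a‖ ≤ ‖a‖) (h1 : f 1 = 1) {a : A}
    (ha : 0 ≤ a) : 0 ≤ f a := by
  have him : (f a).im = 0 := by
    have h (t : ℝ) : (f a).re ^ 2 + ((f a).im + t) ^ 2 ≤ ‖a‖ ^ 2 + t ^ 2 := by
      refine le_trans ?_ (ha.isSelfAdjoint.norm_add_algebraMap_I_sq_le t)
      refine le_trans (le_of_eq ?_) (pow_le_pow_left₀ (norm_nonneg _) (hf _) 2)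
      rw [map_add, Algebra.algebraMap_eq_smul_one, map_smul, h1, ← Complex.normSq_eq_norm_sq,
        Complex.normSq_apply]
      simp
      ring
    by_contra h0
    -- The `t²` terms cancel in `h`; this `t` makes the remaining cross term `‖a‖² + 1`, which is
    -- too large.
    have := h ((‖a‖ ^ 2 + 1) / (2 * (f a).im))
    have h2 : 2 * (f a).im * ((‖a‖ ^ 2 + 1) / (2 * (f a).im)) = ‖a‖ ^ 2 + 1 := by
      field_simp
    nlinarith [sq_nonneg (f a).re, sq_nonneg (f a).im]
  have hre : 0 ≤ (f a).re := by
    have h := (hf _).trans (norm_two_smul_sub_algebraMap_norm_le ha)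
    have h2 : f ((2 : ℝ) • a - algebraMap ℝ A ‖a‖) = 2 * f a - ‖a‖ := by
      rw [Algebra.algebraMap_eq_smul_one, map_sub, ← Complex.coe_smul, ← Complex.coe_smul,
        map_smul, map_smul, h1]
      simp
    rw [h2] at h
    have h3 := (abs_le.mp ((Complex.abs_re_le_norm _).trans h)).1
    simp at h3
    linarith
  exact Complex.nonneg_iff.mpr ⟨hre, him.symm⟩

theorem exists_state_eq_norm {A : Type*} [CStarAlgebra A] [PartialOrder A] [StarOrderedRing A]
    {a : A} (ha : 0 ≤ a) (ha0 : a ≠ 0) :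
    ∃ f : A →ₗ[ℂ] ℂ, (∀ b, ‖f b‖ ≤ ‖b‖) ∧ (∀ b, 0 ≤ b → 0 ≤ f b) ∧ f a = ‖a‖ := by
  obtain ⟨f, hf, hfa⟩ := exists_dual_vector'' ℂ a
  have : Nontrivial A := ⟨a, 0, ha0⟩
  have hpos : 0 < ‖a‖ := norm_pos_iff.mpr ha0
  have hb (b : A) : ‖f b‖ ≤ ‖b‖ := f.le_of_opNorm_le_of_le hf le_rfl |>.trans_eq (one_mul _)
  -- A Hahn–Banach functional norming `a ≥ 0` is unital: `|2 - f 1| ≤ 1` and `|f 1| ≤ 1` describe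
  -- two discs touching only at `1`.
  have h1 : f 1 = 1 := by
    have h := (hb _).trans (norm_two_smul_sub_algebraMap_norm_le ha)
    have h2 : f ((2 : ℝ) • a - algebraMap ℝ A ‖a‖) = ‖a‖ * (2 - f 1) := by
      rw [Algebra.algebraMap_eq_smul_one, map_sub, ← Complex.coe_smul, ← Complex.coe_smul,
        map_smul, map_smul, hfa]
      simp
      ring
    rw [h2, norm_mul, Complex.norm_real, norm_norm] at h
    have h3 : ‖2 - f 1‖ ≤ 1 := le_of_mul_le_mul_left (by linarith) hpos
    have h4 : ‖f 1‖ ≤ 1 := (hb 1).trans_eq (by simp)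
    have h5 : (f 1).re = 1 := by
      have := (Complex.re_le_norm _).trans h3
      have := (Complex.re_le_norm _).trans h4
      simp at *
      linarith
    have h6 : (f 1).im = 0 := by
      have := Complex.normSq_eq_norm_sq (f 1)
      rw [Complex.normSq_apply, h5] at this
      have h7 : ‖f 1‖ ^ 2 ≤ 1 := pow_le_one₀ (norm_nonneg _) h4
      nlinarith
    exact Complex.ext h5 h6
  exact ⟨f, hb, fun b hb0 => nonneg_of_unital_contractive (f : A →ₗ[ℂ] ℂ) hb h1 hb0, hfa⟩

theorem exists_contractive_positive_eq_norm {A : Type*} [NonUnitalCStarAlgebra A]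
    [PartialOrder A] [StarOrderedRing A] {a : A} (ha : 0 ≤ a) (ha0 : a ≠ 0) :
    ∃ f : A →ₗ[ℂ] ℂ, (∀ b, ‖f b‖ ≤ ‖b‖) ∧ (∀ b, 0 ≤ b → 0 ≤ f b) ∧ f a = ‖a‖ := by
  open scoped CStarAlgebra in
  obtain ⟨f, hf, hpos, hfa⟩ := exists_state_eq_norm (A := Unitization ℂ A)
    (Unitization.inr_nonneg_iff.mpr ha) (fun h => ha0 (Unitization.inr_injective h))
  refine ⟨f.comp (Unitization.inrHom ℂ ℂ A), fun b => ?_, fun b hb => ?_, ?_⟩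
  · simpa [Unitization.norm_inr] using hf (b : Unitization ℂ A)
  · simpa using hpos _ (Unitization.inr_nonneg_iff.mpr hb)
  · simpa [Unitization.norm_inr] using hfa

end States

/-! ### Tensors `b ⊗ h` and the transfer of lower bounds. -/

namespace SelfadjointOperatorSpace

variable {C : Type u} [NonUnitalCStarAlgebra C] [PartialOrder C] [StarOrderedRing C]

/-- The diagonal embedding of a C⋆-algebra into its matrices. -/
def diagonalHom (n : ℕ) (B : Type u) [NonUnitalCStarAlgebra B] :
    B →⋆ₙₐ[ℂ] CStarMatrix (Fin n) (Fin n) B where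
  toFun := fun a => CStarMatrix.ofMatrix (Matrix.diagonal fun _ => a)
  map_smul' := fun c a => (Matrix.diagonal_smul c fun _ => a)
  map_zero' := Matrix.diagonal_zero
  map_add' := fun a b => (Matrix.diagonal_add (fun _ => a) fun _ => b).symm
  map_mul' := fun a b => (Matrix.diagonal_mul_diagonal (fun _ => a) fun _ => b).symm
  map_star' := fun a => (Matrix.diagonal_conjTranspose fun _ => a).symm

theorem diagonalHom_apply (n : ℕ) {B : Type u} [NonUnitalCStarAlgebra B] (a : B) (i j : Fin n) :
    diagonalHom n B a i j = if i = j then a else 0 := Matrix.diagonal_apply ..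

section Functional

variable {B : Type u} [NonUnitalCStarAlgebra B] {G : SelfadjointOperatorSpace B}

theorem toCStarMatrix_one_by_one (y : G.toSubmodule) :
    G.toCStarMatrix (Matrix.of fun _ _ => y) = diagonalHom 1 B (y : B) := by
  ext i j
  rw [diagonalHom_apply, if_pos (Subsingleton.elim i j)]
  rfl

variable [PartialOrder B] [StarOrderedRing B]
  {φ : G.toSubmodule →ₗ[ℂ] (whole ℂ).toSubmodule}

/-- Complete positivity speaks only of matrix cones; this is its case of size one, read off the
single entry. -/
theorem CCP_map_nonneg (hφ : φ ∈ CCP G (whole ℂ)) {y : G.toSubmodule} (hy : 0 ≤ (y : B)) :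
    0 ≤ (φ y : ℂ) := by
  obtain ⟨s, hs⟩ := exists_star_mul_self_of_nonneg hy
  have h : (Matrix.of fun _ _ => y) ∈ G.cone 1 := by
    show 0 ≤ G.toCStarMatrix (Matrix.of fun _ _ => y)
    rw [toCStarMatrix_one_by_one, hs, map_mul, map_star]
    exact star_mul_self_nonneg _
  obtain ⟨t, ht⟩ := exists_star_mul_self_of_nonneg (show 0 ≤ (whole ℂ).toCStarMatrix _ from
    hφ.2.2 1 _ h)
  have h2 := congrFun (congrFun ht 0) 0
  rw [show (φ y : ℂ) = (star t * t) 0 0 from h2, CStarMatrix.mul_apply, Fin.sum_univ_one,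
    CStarMatrix.star_apply]
  exact star_mul_self_nonneg _

theorem CCP_norm_le (hφ : φ ∈ CCP G (whole ℂ)) (y : G.toSubmodule) :
    ‖(φ y : ℂ)‖ ≤ ‖(y : B)‖ := by
  have h1 := hφ.1 1 (Matrix.of fun _ _ => y)
  rw [toCStarMatrix_one_by_one] at h1
  exact ((CStarMatrix.norm_entry_le_norm (i := 0) (j := 0)).trans h1).trans
    (NonUnitalStarAlgHom.norm_apply_le (diagonalHom 1 B) (y : B))

end Functional

/-- Scalar matrices times a fixed element `h` of `E`, as elements of `M_n(E)`. -/
def scalarTensor (E : SelfadjointOperatorSpace C) (n : ℕ) {h : C} (hE : h ∈ E.toSubmodule) :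
    Matrix (Fin n) (Fin n) ℂ →ₗ[ℂ] (E.matrixSpace n).toSubmodule where
  toFun c := ⟨fun i j => c i j • h, fun i j => E.toSubmodule.smul_mem _ hE⟩
  map_add' c d := Subtype.ext <| by ext i j; exact add_smul _ _ _
  map_smul' c d := Subtype.ext <| by ext i j; exact smul_assoc c (d i j) h

theorem scalarTensor_apply (E : SelfadjointOperatorSpace C) (n : ℕ) {h : C}
    (hE : h ∈ E.toSubmodule) (c : Matrix (Fin n) (Fin n) ℂ) (i j : Fin n) :
    (E.scalarTensor n hE c : CStarMatrix (Fin n) (Fin n) C) i j = c i j • h := rfl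

/-- If `c = d* d` and `h = s* s`, then `c ⊗ h = (d ⊗ s)* (d ⊗ s)`. The factor `s` need not lie in
`E`. -/
theorem scalarTensor_nonneg (E : SelfadjointOperatorSpace C) (n : ℕ) {h : C}
    (hE : h ∈ E.toSubmodule) (h0 : 0 ≤ h) {c : Matrix (Fin n) (Fin n) ℂ} (hc : c.PosSemidef) :
    0 ≤ (E.scalarTensor n hE c : CStarMatrix (Fin n) (Fin n) C) := by
  obtain ⟨s, hs⟩ := exists_star_mul_self_of_nonneg h0
  open scoped MatrixOrder in
  obtain ⟨d, hd⟩ := CStarAlgebra.nonneg_iff_eq_star_mul_self.mp hc.nonneg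
  have : (E.scalarTensor n hE c : CStarMatrix (Fin n) (Fin n) C) =
      star (CStarMatrix.ofMatrix (Matrix.of fun i j => d i j • s)) *
        CStarMatrix.ofMatrix (Matrix.of fun i j => d i j • s) := by
    ext i j
    rw [scalarTensor_apply, CStarMatrix.mul_apply, hd, hs, Matrix.mul_apply, Finset.sum_smul]
    refine Finset.sum_congr rfl fun k _ => ?_
    simp [CStarMatrix.star_apply, smul_mul_smul_comm, Matrix.star_apply]
  rw [this]
  exact star_mul_self_nonneg _

theorem norm_scalarTensor_one_le (E : SelfadjointOperatorSpace C) (n : ℕ) {h : C}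
    (hE : h ∈ E.toSubmodule) :
    ‖(E.scalarTensor n hE 1 : CStarMatrix (Fin n) (Fin n) C)‖ ≤ ‖h‖ := by
  have : (E.scalarTensor n hE 1 : CStarMatrix (Fin n) (Fin n) C) = diagonalHom n C h := by
    ext i j
    rw [scalarTensor_apply, Matrix.one_apply, diagonalHom_apply]
    split_ifs <;> simp
  rw [this]
  exact NonUnitalStarAlgHom.norm_apply_le (diagonalHom n C) h

/-- If `E` is spanned by a positive element, then lower bounds by `-1` for contractive positive
functionals on `M_n(F)` restrict to lower bounds for those on `M_n(E)`. -/
theorem neg_one_le_re_of_forall_CCP {E F : SelfadjointOperatorSpace C} {h : C} (h0 : 0 ≤ h)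
    (hE : E.toSubmodule = Submodule.span ℂ {h}) {n : ℕ} {y : (E.matrixSpace n).toSubmodule}
    {z : (F.matrixSpace n).toSubmodule}
    (hyz : (y : CStarMatrix (Fin n) (Fin n) C) = z)
    (hz : ∀ φ ∈ CCP (F.matrixSpace n) (whole ℂ), -1 ≤ (φ z : ℂ).re)
    {φ : (E.matrixSpace n).toSubmodule →ₗ[ℂ] (whole ℂ).toSubmodule}
    (hφ : φ ∈ CCP (E.matrixSpace n) (whole ℂ)) : -1 ≤ (φ y : ℂ).re := by
  have hmem : h ∈ E.toSubmodule := hE ▸ Submodule.mem_span_singleton_self h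
  obtain ⟨b, hb⟩ : ∃ b : Matrix (Fin n) (Fin n) ℂ,
      ∀ i j, b i j • h = (y : CStarMatrix (Fin n) (Fin n) C) i j := by
    choose b hb using fun i j => Submodule.mem_span_singleton.mp (hE ▸ y.2 i j)
    exact ⟨b, hb⟩
  obtain rfl : y = E.scalarTensor n hmem b := Subtype.ext <| by
    ext i j
    exact (hb i j).symm
  clear hb
  rcases eq_or_ne h 0 with rfl | hne
  · have : E.scalarTensor n hmem b = 0 := Subtype.ext <| by
      ext i j
      exact smul_zero _
    rw [this, map_zero]
    simp
  have hr : 0 < ‖h‖ := norm_pos_iff.mpr hne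
  obtain ⟨ω, hω, hω0, hωh⟩ := exists_contractive_positive_eq_norm h0 hne
  -- Test `hz` on `ω` composed with compression by `α`, divided by `s = ‖α‖²` to make it
  -- contractive; hence the separate case `s = 0`.
  have hpair (α : Fin n → ℂ) :
      -(∑ i, ‖α i‖ ^ 2) ≤ ‖h‖ * (star α ⬝ᵥ Matrix.mulVec b α).re := by
    obtain ⟨s, hs⟩ : ∃ s, s = ∑ i, ‖α i‖ ^ 2 := ⟨_, rfl⟩
    have hs_nonneg : 0 ≤ s := hs ▸ Finset.sum_nonneg fun i _ => sq_nonneg ‖α i‖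
    rw [← hs]
    rcases hs_nonneg.eq_or_lt' with hs0 | hs0
    · have hα : α = 0 := by
        ext i
        have := (Finset.sum_eq_zero_iff_of_nonneg fun i _ => sq_nonneg ‖α i‖).mp (hs.symm.trans hs0) i
          (Finset.mem_univ i)
        simpa using this
      simp [hs0, hα]
    let g : CStarMatrix (Fin n) (Fin n) C →ₗ[ℂ] ℂ :=
      ((s⁻¹ : ℝ) : ℂ) • ω.comp (CStarMatrix.compression α)
    have hg : (F.matrixSpace n).restrictFunctional g ∈ CCP (F.matrixSpace n) (whole ℂ) := by
      refine restrictFunctional_mem_CCP _ g (fun M => ?_) fun M hM => ?_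
      · simp only [g, LinearMap.smul_apply, LinearMap.comp_apply, norm_smul, Complex.norm_real,
          Real.norm_of_nonneg (inv_nonneg.mpr hs0.le)]
        rw [inv_mul_le_iff₀ hs0]
        exact hs ▸ (hω _).trans (CStarMatrix.norm_compression_le α M)
      · exact mul_nonneg (Complex.zero_le_real.mpr (inv_nonneg.mpr hs0.le))
          (hω0 _ (CStarMatrix.compression_nonneg α hM))
    have h1 := hz _ hg
    have h2 : ((F.matrixSpace n).restrictFunctional g z : ℂ) =
        ((s⁻¹ * ‖h‖ : ℝ) : ℂ) * (star α ⬝ᵥ Matrix.mulVec b α) := by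
      show g z = _
      rw [← hyz]
      simp only [g, LinearMap.smul_apply, LinearMap.comp_apply, CStarMatrix.compression_apply,
        map_sum, map_smul, dotProduct, Matrix.mulVec, smul_eq_mul,
        Finset.mul_sum, Pi.star_apply]
      refine Finset.sum_congr rfl fun i _ => Finset.sum_congr rfl fun j _ => ?_
      rw [scalarTensor_apply, map_smul, hωh]
      push_cast
      rw [smul_eq_mul]
      ring
    rw [h2, Complex.re_ofReal_mul, mul_assoc, ← div_eq_inv_mul, le_div_iff₀ hs0] at h1
    linarith
  set T := E.scalarTensor n hmem
  -- `b` is not assumed Hermitian, so `b + b*` replaces it and doubles the constant in `hpair`.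
  have hpos : (‖h‖ • (b + b.conjTranspose) + (2 : ℝ) • 1 :
      Matrix (Fin n) (Fin n) ℂ).PosSemidef := by
    refine .of_dotProduct_mulVec_nonneg ?_ fun α => ?_
    · simp [Matrix.IsHermitian, add_comm]
    · have hadj : star α ⬝ᵥ Matrix.mulVec b.conjTranspose α =
          star (star α ⬝ᵥ Matrix.mulVec b α) := by
        rw [Matrix.star_dotProduct, Matrix.star_mulVec, Matrix.conjTranspose_conjTranspose,
          Matrix.dotProduct_mulVec]
      have hone : star α ⬝ᵥ α = ((∑ i, ‖α i‖ ^ 2 : ℝ) : ℂ) := by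
        push_cast
        exact Finset.sum_congr rfl fun i _ => Complex.conj_mul' _
      have : star α ⬝ᵥ Matrix.mulVec (‖h‖ • (b + b.conjTranspose) +
          (2 : ℝ) • 1 : Matrix (Fin n) (Fin n) ℂ) α =
          ((2 * (‖h‖ * (star α ⬝ᵥ Matrix.mulVec b α).re + ∑ i, ‖α i‖ ^ 2) : ℝ) :
            ℂ) := by
        simp only [Matrix.add_mulVec, Matrix.smul_mulVec, Matrix.one_mulVec, dotProduct_add,
          dotProduct_smul, hadj, hone]
        rw [Complex.star_def, Complex.add_conj]
        simp only [Complex.real_smul]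
        push_cast
        ring
      rw [this]
      exact Complex.zero_le_real.mpr (by linarith [hpair α])
  have hstar : T b.conjTranspose = star (T b) := Subtype.ext <| by
    ext i j
    show star (b j i) • h = star (b j i • h)
    rw [star_smul, h0.isSelfAdjoint.star_eq]
  have hφ0 := (Complex.nonneg_iff.mp
    (CCP_map_nonneg hφ (E.scalarTensor_nonneg n hmem h0 hpos))).1
  have hφ1 : (φ (T 1) : ℂ).re ≤ ‖h‖ :=
    (Complex.re_le_norm _).trans ((CCP_norm_le hφ _).trans (E.norm_scalarTensor_one_le n hmem))
  have hval : (φ (T (‖h‖ • (b + b.conjTranspose) + (2 : ℝ) • 1)) : ℂ) =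
      ‖h‖ * ((φ (T b) : ℂ) + star (φ (T b) : ℂ)) + 2 * φ (T 1) := by
    rw [← Complex.coe_smul, ← Complex.coe_smul]
    simp only [map_add, map_smul, hstar, hφ.2.1]
    simp only [Submodule.coe_add, Submodule.coe_smul, smul_eq_mul, Complex.ofReal_ofNat]
    rfl
  rw [hval] at hφ0
  simp at hφ0
  -- `hφ0` and `hφ1` give `‖h‖ (Re φ(T b) + 1) ≥ 0`, and `‖h‖ > 0`.
  nlinarith

end SelfadjointOperatorSpace

/-! ### Inclusions and their unitisations. -/

namespace SelfadjointOperatorSpace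

variable {C : Type u} [NonUnitalCStarAlgebra C] {E F : SelfadjointOperatorSpace C}

theorem isSelfAdjoint_map_unitisationMap_inclusion_iff (h : E.toSubmodule ≤ F.toSubmodule) {n : ℕ}
    {Z : Matrix (Fin n) (Fin n) (E.toSubmodule × ℂ)} :
    IsSelfAdjoint (Z.map (unitisationMap (inclusion E F h))) ↔ IsSelfAdjoint Z := by
  have hinj : Function.Injective (unitisationMap (inclusion E F h)) :=
    (Submodule.inclusion_injective h).prodMap Function.injective_id
  have : star (Z.map (unitisationMap (inclusion E F h))) =
      (star Z).map (unitisationMap (inclusion E F h)) := rfl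
  rw [IsSelfAdjoint, IsSelfAdjoint, this]
  exact (Matrix.map_injective hinj).eq_iff

variable [PartialOrder C] [StarOrderedRing C]

theorem inclusion_comp_mem_CCP (h : E.toSubmodule ≤ F.toSubmodule)
    {φ : F.toSubmodule →ₗ[ℂ] (whole ℂ).toSubmodule} (hφ : φ ∈ CCP F (whole ℂ)) :
    φ.comp (inclusion E F h) ∈ CCP E (whole ℂ) :=
  ⟨fun n X => hφ.1 n (X.map (inclusion E F h)), fun v => hφ.2.1 (inclusion E F h v),
    fun n X hX => hφ.2.2 n (X.map (inclusion E F h)) hX⟩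

theorem matrixSpace_mono (h : E.toSubmodule ≤ F.toSubmodule) (n : ℕ) :
    (E.matrixSpace n).toSubmodule ≤ (F.matrixSpace n).toSubmodule :=
  fun _ hX i j => h (hX i j)

theorem toMatrixSpace_scalarSandwich_unitisationMap (h : E.toSubmodule ≤ F.toSubmodule) {n : ℕ}
    (b c : Matrix (Fin n) (Fin n) ℂ) (Z : Matrix (Fin n) (Fin n) (E.toSubmodule × ℂ)) :
    F.toMatrixSpace
        (scalarSandwich b ((Z.map (unitisationMap (inclusion E F h))).map Prod.fst) c) =
      inclusion _ _ (matrixSpace_mono h n)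
        (E.toMatrixSpace (scalarSandwich b (Z.map Prod.fst) c)) := by
  apply Subtype.ext
  ext i j
  show ((∑ k, ∑ l, (b i k * c l j) • inclusion E F h (Z k l).1 : F.toSubmodule) : C) =
    ((∑ k, ∑ l, (b i k * c l j) • (Z k l).1 : E.toSubmodule) : C)
  simp only [Submodule.coe_sum, Submodule.coe_smul]
  rfl

/-- The inclusion of a selfadjoint operator space spanned by a positive element is an
embedding. -/
theorem isEmbedding_inclusion_of_eq_span_nonneg (hEF : E.toSubmodule ≤ F.toSubmodule) {h : C}
    (h0 : 0 ≤ h) (hE : E.toSubmodule = Submodule.span ℂ {h}) :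
    IsEmbedding (inclusion E F hEF) where
  -- Both matrix norms are taken in `M_n(C)`; the cones below likewise.
  completelyIsometric _ _ := rfl
  completeOrderEmbedding :=
    { injective := Submodule.inclusion_injective hEF
      completelyPositive := ⟨fun _ => rfl, fun _ _ hX => hX⟩
      inverse_positive := fun _ _ hX => hX }
  unitisation_unital := by simp [unitisationMap]
  unitisation_completeOrderEmbedding :=
    { injective := (Submodule.inclusion_injective hEF).prodMap Function.injective_id
      completelyPositive := by
        refine ⟨fun _ => rfl, fun n Z hZ =>
          ⟨(isSelfAdjoint_map_unitisationMap_inclusion_iff hEF).mpr hZ.1, hZ.2.1,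
            fun ε hε φ hφ => ?_⟩⟩
        rw [toMatrixSpace_scalarSandwich_unitisationMap]
        -- Every test functional on `M_n(F)` restricts to one on `M_n(E)`; positivity of `h` plays
        -- no role in this direction.
        exact hZ.2.2 ε hε _ (inclusion_comp_mem_CCP (matrixSpace_mono hEF n) hφ)
      inverse_positive := by
        refine fun n Z hZ => ⟨(isSelfAdjoint_map_unitisationMap_inclusion_iff hEF).mp hZ.1,
          hZ.2.1, fun ε hε φ hφ => ?_⟩
        refine neg_one_le_re_of_forall_CCP h0 hE (F := F)
          (z := inclusion _ _ (matrixSpace_mono hEF n) _) rfl (fun ψ hψ => ?_) hφ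
        rw [← toMatrixSpace_scalarSandwich_unitisationMap]
        exact hZ.2.2 ε hε ψ hψ }

end SelfadjointOperatorSpace

theorem exists_nonneg_span_singleton_eq {C : Type*} [NonUnitalCStarAlgebra C] [PartialOrder C]
    [StarOrderedRing C] (x : C) (hx : IsSelfAdjoint x) (hpm : x⁺ = 0 ∨ x⁻ = 0) :
    ∃ h : C, 0 ≤ h ∧ Submodule.span ℂ {x} = Submodule.span ℂ {h} := by
  rcases hpm with hp | hm
  · refine ⟨-x, neg_nonneg.mpr ((CFC.posPart_eq_zero_iff x).mp hp), ?_⟩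
    rw [← Set.neg_singleton, Submodule.span_neg]
  · exact ⟨x, (CFC.negPart_eq_zero_iff x).mp hm, rfl⟩

end

theorem corollary5p3 {C : Type*} [NonUnitalCStarAlgebra C] [PartialOrder C] [StarOrderedRing C]
    (x : C) (hx : IsSelfAdjoint x) (hpm : x⁺ = 0 ∨ x⁻ = 0) :
    SelfadjointOperatorSpace.IsEmbedding (SelfadjointOperatorSpace.inclusion
        (SelfadjointOperatorSpace.spanSingleton x hx)
        (SelfadjointOperatorSpace.whole C)
        (SelfadjointOperatorSpace.le_whole _)) ∧
      SelfadjointOperatorSpace.IsEmbedding (SelfadjointOperatorSpace.inclusion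
        (SelfadjointOperatorSpace.spanSingleton x hx)
        (SelfadjointOperatorSpace.spanSingleton x hx).generatedCStarAlgebra
        (SelfadjointOperatorSpace.le_generatedCStarAlgebra _)) := by
  obtain ⟨h, h0, hh⟩ := exists_nonneg_span_singleton_eq x hx hpm
  exact ⟨SelfadjointOperatorSpace.isEmbedding_inclusion_of_eq_span_nonneg _ h0 hh,
    SelfadjointOperatorSpace.isEmbedding_inclusion_of_eq_span_nonneg _ h0 hh⟩
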